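/- Let $m\ge 1$ be an integer and let $\{T(t)\}_{t\ge 0}$ be a $C_0$-semigroup of bounded linear operators on a separable complex Hilbert space $H$, that is, $T(0)=I$, $T(s+t)=T(t)T(s)$ for all $s,t\ge 0$, and $\lim_{t\to 0^+}T(t)x=x$ for every $x\in H$. Let $A$ be its infinitesimal generator, $Ax=\lim_{t\to 0^+}\frac{T(t)x-x}{t}$, with domain $D(A)$ the set of all $x\in H$ for which this limit exists; let $A^0=I$ with $D(A^0)=H$, and $A^{n+1}x=A(A^nx)$ on $D(A^{n+1})=\{x\in D(A^n): A^nx\in D(A)\}$. A bounded operator $T$ on $H$ is called an $m$-isometry if $$\sum_{k=0}^m\binom mk(-1)^{m-k}\|T^kx\|^2=0\qquad\text{for all }x\in H.$$ If $1$ lies in the resolvent set $\rho(A)$, i.e. if $A-I:D(A)\to H$ is a bijection with bounded inverse, the bounded operator $V=(A+I)(A-I)^{-1}$ is called the cogenerator of $\{T(t)\}_{t\ge0}$; otherwise the cogenerator does not exist. Then the following conditions are equivalent: (i) $T(t)$ is an $m$-isometry for every $t\ge 0$. (ii) For each $x\in H$ the function $t\mapsto\|T(t)x\|^2$ on $[0,\infty)$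 is a polynomial of degree less than $m$ (the zero polynomial being allowed). (iii) For every $x\in D(A^m)$, $$\sum_{k=0}^m\binom mk\langle A^{m-k}x,A^kx\rangle=0.$$ (iv) The cogenerator $V$ of $\{T(t)\}_{t\ge0}$ exists (i.e. $1\in\rho(A)$) and is an $m$-isometry. -/

import Mathlib

open Filter Topology
open scoped NNReal InnerProductSpace

noncomputable section

namespace SemigroupMIsometry

variable {H : Type*} [NormedAddCommGroup H] [InnerProductSpace ℂ H]

/-- A `C₀`-semigroup `{T(t)}_{t ≥ 0}` of bounded linear operators on `H`. -/
structure C0Semigroup (H : Type*) [NormedAddCommGroup H] [InnerProductSpace ℂ H] where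
  T : ℝ≥0 → H →L[ℂ] H
  map_zero : T 0 = ContinuousLinearMap.id ℂ H
  map_add : ∀ s t : ℝ≥0, T (s + t) = (T t).comp (T s)
  tendsto_zero : ∀ x : H, Tendsto (fun t : ℝ≥0 => T t x) (𝓝[>] 0) (𝓝 x)

/-- `y` is the limit of `(T(t)x - x) / t` as `t → 0⁺`. -/
def C0Semigroup.HasGenLimit (S : C0Semigroup H) (x y : H) : Prop :=
  Tendsto (fun t : ℝ≥0 => ((t : ℝ) : ℂ)⁻¹ • (S.T t x - x)) (𝓝[>] 0) (𝓝 y)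

theorem C0Semigroup.HasGenLimit.unique {S : C0Semigroup H} {x y z : H}
    (hy : S.HasGenLimit x y) (hz : S.HasGenLimit x z) : y = z :=
  tendsto_nhds_unique hy hz

theorem C0Semigroup.HasGenLimit.add {S : C0Semigroup H} {x y u v : H}
    (hx : S.HasGenLimit x u) (hy : S.HasGenLimit y v) : S.HasGenLimit (x + y) (u + v) := by
  refine (Tendsto.add hx hy).congr fun t => ?_
  rw [← smul_add, _root_.map_add]
  congr 1
  abel

theorem C0Semigroup.HasGenLimit.smul {S : C0Semigroup H} {x u : H} (c : ℂ)
    (hx : S.HasGenLimit x u) : S.HasGenLimit (c • x) (c • u) := by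
  refine (Tendsto.const_smul hx c).congr fun t => ?_
  rw [smul_comm, smul_sub, map_smul]

/-- The infinitesimal generator `A` of the semigroup: `D(A)` consists of those `x` for which
`lim_{t → 0⁺} (T(t)x - x) / t` exists, and `A x` is that limit. -/
def C0Semigroup.generator (S : C0Semigroup H) : H →ₗ.[ℂ] H where
  domain :=
    { carrier := {x | ∃ y, S.HasGenLimit x y}
      zero_mem' := ⟨0, by simp [C0Semigroup.HasGenLimit]⟩
      add_mem' := fun ⟨u, hu⟩ ⟨v, hv⟩ => ⟨u + v, hu.add hv⟩
      smul_mem' := fun c _ ⟨u, hu⟩ => ⟨c • u, hu.smul c⟩ }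
  toFun :=
    { toFun := fun x => Classical.choose x.2
      map_add' := fun x y => (Classical.choose_spec (x + y).2).unique
        ((Classical.choose_spec x.2).add (Classical.choose_spec y.2))
      map_smul' := fun c x => (Classical.choose_spec (c • x).2).unique
        ((Classical.choose_spec x.2).smul c) }

theorem C0Semigroup.generator_spec (S : C0Semigroup H) (x : S.generator.domain) :
    S.HasGenLimit (x : H) (S.generator x) :=
  Classical.choose_spec x.2

theorem C0Semigroup.mem_generator_domain (S : C0Semigroup H) (x : H) :
    x ∈ S.generator.domain ↔ ∃ y, S.HasGenLimit x y :=
  Iff.rfl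

/-- The composition `A B` of unbounded operators on its maximal domain
`{x ∈ D(B) | B x ∈ D(A)}`. -/
def opComp (A B : H →ₗ.[ℂ] H) : H →ₗ.[ℂ] H where
  domain :=
    { carrier := {x | ∃ hx : x ∈ B.domain, B ⟨x, hx⟩ ∈ A.domain}
      zero_mem' := ⟨Submodule.zero_mem _, by
        have h : B ⟨0, Submodule.zero_mem _⟩ = 0 := B.map_zero
        rw [h]; exact Submodule.zero_mem _⟩
      add_mem' := fun {x y} ⟨hx, hx'⟩ ⟨hy, hy'⟩ => ⟨Submodule.add_mem _ hx hy, by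
        have h : B ⟨x + y, Submodule.add_mem _ hx hy⟩ = B ⟨x, hx⟩ + B ⟨y, hy⟩ :=
          B.map_add ⟨x, hx⟩ ⟨y, hy⟩
        rw [h]; exact Submodule.add_mem _ hx' hy'⟩
      smul_mem' := fun c x ⟨hx, hx'⟩ => ⟨Submodule.smul_mem _ c hx, by
        have h : B ⟨c • x, Submodule.smul_mem _ c hx⟩ = c • B ⟨x, hx⟩ :=
          B.map_smul c ⟨x, hx⟩
        rw [h]; exact Submodule.smul_mem _ c hx'⟩ }
  toFun :=
    { toFun := fun x => A ⟨B ⟨x, x.2.1⟩, x.2.2⟩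
      map_add' := fun x y => by
        rw [← A.map_add]
        congr 1
        exact Subtype.ext (B.map_add ⟨x, x.2.1⟩ ⟨y, y.2.1⟩)
      map_smul' := fun c x => by
        rw [RingHom.id_apply, ← A.map_smul]
        congr 1
        exact Subtype.ext (B.map_smul c ⟨x, x.2.1⟩) }

/-- The power `A ^ n` of an unbounded operator on its maximal domain: `D(A ^ 0) = H`,
`D(A ^ (n + 1)) = {x ∈ D(A ^ n) | A ^ n x ∈ D(A)}` and `A ^ (n + 1) x = A (A ^ n x)`. -/
def opPow (A : H →ₗ.[ℂ] H) : ℕ → (H →ₗ.[ℂ] H)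
  | 0 => LinearMap.toPMap LinearMap.id ⊤
  | n + 1 => opComp A (opPow A n)

theorem opPow_domain_succ_le (A : H →ₗ.[ℂ] H) (n : ℕ) :
    (opPow A (n + 1)).domain ≤ (opPow A n).domain :=
  fun _ hx => hx.1

theorem opPow_domain_anti (A : H →ₗ.[ℂ] H) : Antitone fun n => (opPow A n).domain :=
  antitone_nat_of_succ_le (opPow_domain_succ_le A)

/-- The vector `A ^ k x` for `x ∈ D(A ^ m)` and `k ≤ m`. -/
def opPowOn (A : H →ₗ.[ℂ] H) {m k : ℕ} (hk : k ≤ m) (x : (opPow A m).domain) : H :=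
  opPow A k ⟨x, opPow_domain_anti A hk x.2⟩

/-- `R` is the bounded two-sided inverse `(A - z I)⁻¹ : H → D(A)` of `A - z I : D(A) → H`. -/
structure IsShiftInverse (A : H →ₗ.[ℂ] H) (z : ℂ) (R : H →L[ℂ] H) : Prop where
  mem_domain : ∀ y : H, R y ∈ A.domain
  right_inv : ∀ y : H, A ⟨R y, mem_domain y⟩ - z • R y = y
  left_inv : ∀ x : A.domain, R (A x - z • (x : H)) = x

/-- The resolvent set `ρ(A)` of an unbounded operator. -/
def resolventSet (A : H →ₗ.[ℂ] H) : Set ℂ :=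
  {z | ∃ R : H →L[ℂ] H, IsShiftInverse A z R}

/-- `V` is the cogenerator `(A + I)(A - I)⁻¹` of the semigroup with generator `A`; in particular
`1 ∈ ρ(A)`. -/
def C0Semigroup.IsCogenerator (S : C0Semigroup H) (V : H →L[ℂ] H) : Prop :=
  ∃ (R : H →L[ℂ] H) (hR : IsShiftInverse S.generator 1 R),
    ∀ y : H, V y = S.generator ⟨R y, hR.mem_domain y⟩ + R y

/-- The cogenerator exists exactly when `1 ∈ ρ(A)`. -/
theorem C0Semigroup.exists_isCogenerator_iff (S : C0Semigroup H) :
    (∃ V, S.IsCogenerator V) ↔ (1 : ℂ) ∈ resolventSet S.generator := by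
  constructor
  · rintro ⟨V, R, hR, -⟩
    exact ⟨R, hR⟩
  · rintro ⟨R, hR⟩
    refine ⟨ContinuousLinearMap.id ℂ H + (2 : ℂ) • R, R, hR, fun y => ?_⟩
    have h := hR.right_inv y
    rw [one_smul, sub_eq_iff_eq_add] at h
    rw [h]
    simp [two_smul, add_assoc]

theorem C0Semigroup.IsCogenerator.unique {S : C0Semigroup H} {V W : H →L[ℂ] H}
    (hV : S.IsCogenerator V) (hW : S.IsCogenerator W) : V = W := by
  obtain ⟨R, hR, hV⟩ := hV
  obtain ⟨Q, hQ, hW⟩ := hW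
  have hRQ : R = Q := by
    ext y
    have h := hQ.left_inv ⟨R y, hR.mem_domain y⟩
    rw [hR.right_inv y] at h
    exact h.symm
  subst hRQ
  ext y
  rw [hV, hW]

/-- `T` is an `m`-isometry: `∑ₖ (-1)^(m-k) C(m,k) ‖T^k x‖² = 0` for all `x`. -/
def IsMIsometry (m : ℕ) (T : H →L[ℂ] H) : Prop :=
  ∀ x : H, ∑ k ∈ Finset.range (m + 1),
    (m.choose k : ℝ) * (-1 : ℝ) ^ (m - k) * ‖(T ^ k) x‖ ^ 2 = 0

end SemigroupMIsometry

end

/-!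
All four conditions are compared through *chains* of the generator `A`: sequences `u` with
`u_{k+1} = A u_k` for `k < m`. A chain is the same thing as a vector `u₀ ∈ D(A ^ m)`
(`forall_opPowOn_iff`), and the infinitesimal condition says that
`binomForm m u = ∑ₖ C(m,k) ⟪u_{m-k}, u_k⟫` vanishes for every chain.

*Semigroup and polynomials.* Since `T(t) ^ k T(s) = T(s + k t)`, the operators `T(t)` are all
`m`-isometries exactly when the `m`-th differences of `t ↦ ‖T(t) x‖²` vanish for every `x`. Orbits
being continuous, Fréchet's theorem (`exists_polynomial_of_sum_choose_eq_zero`) turns this into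
being a polynomial of degree less than `m`.

*Polynomials and generator.* The functions `t ↦ binomForm n (T(t) u)` for `n ≤ m` start with
`‖T(t) u₀‖²`, and each is the derivative of the preceding one, by the Leibniz rule and Pascal's
identity (`IsChain.hasDerivWithinAt_binomForm`). If `‖T(t) u₀‖²` is a polynomial of degree less than
`m`, the `m`-th of these vanishes. Conversely, if the `m`-th vanishes, Taylor's formula gives the
polynomial for `u₀ ∈ D(A ^ m)`, hence the `m`-isometry identity for `u₀`; that identity is
continuous in the vector and `D(A ^ m)` is dense (`dense_chain`).

*Generator and cogenerator.* Suppose `R = (A - 1)⁻¹` exists and put `B = A R = 1 + R`, so that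
`V = B + R` while `1 = B - R`. Chains are then exactly the sequences `u_k = B ^ k R ^ (m-k) y`, and
the identity `(b + r)(b' + r') - (b - r)(b' - r') = 2 (b r' + r b')`, raised to the power `m`, shows
that the `m`-isometry defect of `V` at `y` is `2 ^ m` times `binomForm m u`
(`defectForm_eq_symForm`).

*Existence of the cogenerator.* If every `‖T(t) x‖²` is a polynomial, the uniform boundedness
principle gives `‖T(t)‖ ≤ K e^{t/2}` (`exists_norm_le_mul_exp`), so `∫₀^∞ e^{-t} T(t) dt` converges,
and it is `-(A - 1)⁻¹` (`one_mem_resolventSet`).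
-/

namespace SemigroupMIsometry

open Finset.HasAntidiagonal (antidiagonal mem_antidiagonal)

variable {H : Type*} [NormedAddCommGroup H] [InnerProductSpace ℂ H]

/-! ### Chains of the generator -/

/-- The sequence `u` starts with `u₀, A u₀, …, A ^ m u₀`; the entries beyond index `m` are
arbitrary. Such a sequence with `u₀ = x` exists exactly when `x ∈ D(A ^ m)`. -/
noncomputable def C0Semigroup.IsChain (S : C0Semigroup H) (m : ℕ) (u : ℕ → H) : Prop :=
  ∀ k < m, S.HasGenLimit (u k) (u (k + 1))

/-- The form `∑ₖ C(n,k) ⟪u_{n-k}, u_k⟫`. -/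
noncomputable def binomForm (n : ℕ) (u : ℕ → H) : ℂ :=
  ∑ ij ∈ antidiagonal n, n.choose ij.1 • ⟪u ij.2, u ij.1⟫_ℂ

theorem C0Semigroup.IsChain.mono {S : C0Semigroup H} {m n : ℕ} {u : ℕ → H}
    (hu : S.IsChain m u) (h : n ≤ m) : S.IsChain n u :=
  fun k hk => hu k (hk.trans_le h)

theorem C0Semigroup.IsChain.exists_opPow_eq {S : C0Semigroup H} {u : ℕ → H} {m : ℕ}
    (hu : S.IsChain m u) :
    ∃ hx : u 0 ∈ (opPow S.generator m).domain, opPow S.generator m ⟨u 0, hx⟩ = u m := by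
  induction m with
  | zero => exact ⟨Submodule.mem_top, rfl⟩
  | succ m ih =>
    obtain ⟨hx, e⟩ := ih (hu.mono m.le_succ)
    have h : opPow S.generator m ⟨u 0, hx⟩ ∈ S.generator.domain := by
      rw [e]; exact ⟨_, hu m m.lt_succ_self⟩
    refine ⟨⟨hx, h⟩, ?_⟩
    have h1 := S.generator_spec ⟨_, h⟩
    have h2 := hu m m.lt_succ_self
    rw [← e] at h2
    exact h1.unique h2

theorem C0Semigroup.isChain_opPowOn (S : C0Semigroup H) {m : ℕ}
    (x : (opPow S.generator m).domain) :
    S.IsChain m fun k => if h : k ≤ m then opPowOn S.generator h x else 0 := by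
  intro k hk
  have hk' : k + 1 ≤ m := hk
  simp only [hk.le, hk', dif_pos]
  have hx : (x : H) ∈ (opPow S.generator (k + 1)).domain :=
    opPow_domain_anti S.generator hk' x.2
  exact S.generator_spec ⟨_, hx.2⟩

/-- The sum in the infinitesimal condition, expressed through chains instead of domains. -/
theorem C0Semigroup.forall_opPowOn_iff (S : C0Semigroup H) (m : ℕ) :
    (∀ x : (opPow S.generator m).domain,
      ∑ k : Fin (m + 1), (m.choose k : ℂ) *
        ⟪opPowOn S.generator (Nat.sub_le m k) x, opPowOn S.generator (Fin.is_le k) x⟫_ℂ = 0) ↔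
      ∀ u, S.IsChain m u → binomForm m u = 0 := by
  have key : ∀ u : ℕ → H, binomForm m u =
      ∑ k : Fin (m + 1), (m.choose k : ℂ) * ⟪u (m - k), u k⟫_ℂ := fun u => by
    rw [binomForm, Finset.Nat.sum_antidiagonal_eq_sum_range_succ
      (fun i j => m.choose i • ⟪u j, u i⟫_ℂ), Finset.sum_range]
    simp
  constructor
  · intro h u hu
    obtain ⟨hx, -⟩ := hu.exists_opPow_eq
    have hp : ∀ k (hk : k ≤ m), opPowOn S.generator hk ⟨u 0, hx⟩ = u k := fun k hk =>
      (hu.mono hk).exists_opPow_eq.2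
    have := h ⟨u 0, hx⟩
    simp only [hp] at this
    rw [key, this]
  · intro h x
    have := h _ (S.isChain_opPowOn x)
    rw [key] at this
    rw [← this]
    refine Finset.sum_congr rfl fun k _ => ?_
    simp only [Fin.is_le k, Nat.sub_le, dif_pos]

/-! ### The binomial identity for the cogenerator -/

/-- The sesquilinear form `∑ₖ C(m,k) ⟪B ^ (m-k) R ^ k x, B ^ k R ^ (m-k) y⟫`. -/
noncomputable def symForm (B R : H →L[ℂ] H) (m : ℕ) (x y : H) : ℂ :=
  ∑ ij ∈ antidiagonal m,
    m.choose ij.1 • ⟪(B ^ ij.2 * R ^ ij.1) x, (B ^ ij.1 * R ^ ij.2) y⟫_ℂ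

/-- The sesquilinear form `∑ₖ (-1)^(m-k) C(m,k) ⟪V ^ k x, V ^ k y⟫`. -/
noncomputable def defectForm (V : H →L[ℂ] H) (m : ℕ) (x y : H) : ℂ :=
  ∑ ij ∈ antidiagonal m, m.choose ij.1 • ((-1) ^ ij.2 * ⟪(V ^ ij.1) x, (V ^ ij.1) y⟫_ℂ)

theorem defectForm_succ (V : H →L[ℂ] H) (m : ℕ) (x y : H) :
    defectForm V (m + 1) x y = defectForm V m (V x) (V y) - defectForm V m x y := by
  rw [defectForm, Finset.sum_antidiagonal_choose_succ_nsmul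
    (fun i j => (-1) ^ j * ⟪(V ^ i) x, (V ^ i) y⟫_ℂ), add_comm, sub_eq_add_neg, defectForm,
    defectForm, ← Finset.sum_neg_distrib]
  congr 1
  · refine Finset.sum_congr rfl fun ij h => ?_
    rw [Nat.choose_symm_of_eq_add (mem_antidiagonal.1 h).symm, pow_succ]
    rfl
  · refine Finset.sum_congr rfl fun ij _ => ?_
    rw [pow_succ, mul_neg_one, neg_mul, smul_neg]

theorem symForm_succ {B R : H →L[ℂ] H} (hc : Commute B R) (m : ℕ) (x y : H) :
    symForm B R (m + 1) x y = symForm B R m (B x) (R y) + symForm B R m (R x) (B y) := by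
  rw [symForm, Finset.sum_antidiagonal_choose_succ_nsmul
    (fun i j => ⟪(B ^ j * R ^ i) x, (B ^ i * R ^ j) y⟫_ℂ), symForm, symForm]
  have hBR : ∀ i j (z : H), (B ^ (i + 1) * R ^ j) z = (B ^ i * R ^ j) (B z) := fun i j z => by
    rw [pow_succ, mul_assoc, (hc.pow_right j).eq, ← mul_assoc]; rfl
  have hRB : ∀ i j (z : H), (B ^ i * R ^ (j + 1)) z = (B ^ i * R ^ j) (R z) := fun i j z => by
    rw [pow_succ, ← mul_assoc]; rfl
  simp only [hBR, hRB]
  congr 1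
  refine Finset.sum_congr rfl fun ij h => ?_
  rw [Nat.choose_symm_of_eq_add (mem_antidiagonal.1 h).symm]

theorem symForm_add_left (B R : H →L[ℂ] H) (m : ℕ) (x x' y : H) :
    symForm B R m (x + x') y = symForm B R m x y + symForm B R m x' y := by
  simp only [symForm, map_add, inner_add_left, smul_add, Finset.sum_add_distrib]

theorem symForm_add_right (B R : H →L[ℂ] H) (m : ℕ) (x y y' : H) :
    symForm B R m x (y + y') = symForm B R m x y + symForm B R m x y' := by
  simp only [symForm, map_add, inner_add_right, smul_add, Finset.sum_add_distrib]

theorem symForm_sub_left (B R : H →L[ℂ] H) (m : ℕ) (x x' y : H) :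
    symForm B R m (x - x') y = symForm B R m x y - symForm B R m x' y := by
  simp only [symForm, map_sub, inner_sub_left, smul_sub, Finset.sum_sub_distrib]

theorem symForm_sub_right (B R : H →L[ℂ] H) (m : ℕ) (x y y' : H) :
    symForm B R m x (y - y') = symForm B R m x y - symForm B R m x y' := by
  simp only [symForm, map_sub, inner_sub_right, smul_sub, Finset.sum_sub_distrib]

/-- The hereditary identity `((b + r)(b' + r') - (b - r)(b' - r')) ^ m = 2 ^ m (b r' + r b') ^ m`,
in the case `b - r = 1`, read as an identity of sesquilinear forms. -/
theorem defectForm_eq_symForm {B R V : H →L[ℂ] H} (hc : Commute B R) (h1 : B - R = 1)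
    (hV : V = B + R) (m : ℕ) (x y : H) :
    defectForm V m x y = 2 ^ m * symForm B R m x y := by
  induction m generalizing x y with
  | zero => simp [defectForm, symForm]
  | succ m ih =>
    have hx : ∀ z : H, z = B z - R z := fun z => by
      rw [← sub_apply, h1]; rfl
    have hVz : ∀ z : H, V z = B z + R z := fun z => by rw [hV]; rfl
    rw [defectForm_succ, ih, ih, symForm_succ hc]
    have e : symForm B R m x y = symForm B R m (B x - R x) (B y - R y) := by
      rw [← hx, ← hx]
    rw [e, hVz, hVz]
    simp only [symForm_add_left, symForm_add_right, symForm_sub_left, symForm_sub_right]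
    ring

theorem isMIsometry_iff_defectForm (m : ℕ) (V : H →L[ℂ] H) :
    IsMIsometry m V ↔ ∀ y, defectForm V m y y = 0 := by
  refine forall_congr' fun y => ?_
  rw [defectForm, Finset.Nat.sum_antidiagonal_eq_sum_range_succ
    (fun i j => m.choose i • ((-1) ^ j * ⟪(V ^ i) y, (V ^ i) y⟫_ℂ)), ← Complex.ofReal_inj]
  push_cast
  simp only [inner_self_eq_norm_sq_to_K, nsmul_eq_mul, mul_assoc]
  rfl

/-- If `R = (A - 1)⁻¹` and `B = 1 + R = A (A - 1)⁻¹`, then every chain of the generator has the form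
`u_k = B ^ k R ^ (m - k) y`, where `y = (A - 1) ^ m u₀`. -/
theorem C0Semigroup.IsChain.exists_resolvent_form {S : C0Semigroup H} {R : H →L[ℂ] H}
    (hR : IsShiftInverse S.generator 1 R) {m : ℕ} {u : ℕ → H} (hu : S.IsChain m u) :
    ∃ y, ∀ k ≤ m, u k = ((1 + R) ^ k * R ^ (m - k)) y := by
  have hc : Commute (1 + R) R := (Commute.one_left R).add_left (Commute.refl R)
  induction m generalizing u with
  | zero => exact ⟨u 0, fun k hk => by simp [Nat.le_zero.1 hk]⟩
  | succ m ih =>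
    -- The differences `u_{k+1} - u_k = (A - 1) u_k` form a chain of length `m`.
    obtain ⟨y, hy⟩ := ih (u := fun k => u (k + 1) - u k) (fun k hk => by
      have h := (hu (k + 1) (by omega)).add ((hu k (by omega)).smul (-1))
      simpa [sub_eq_add_neg] using h)
    have hur : ∀ k ≤ m, u k = R (u (k + 1) - u k) := fun k hk => by
      have hk := hu k (by omega)
      have h := hR.left_inv ⟨u k, _, hk⟩
      rw [(S.generator_spec ⟨u k, _, hk⟩).unique hk] at h
      simpa using h.symm
    have huk : ∀ k ≤ m, u k = ((1 + R) ^ k * R ^ (m + 1 - k)) y := fun k hk => by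
      have hyk : u (k + 1) - u k = ((1 + R) ^ k * R ^ (m - k)) y := hy k hk
      rw [hur k hk, hyk, Nat.succ_sub hk, pow_succ', ← mul_assoc, (hc.pow_left k).eq, mul_assoc]
      rfl
    refine ⟨y, fun k hk => ?_⟩
    rcases Nat.lt_or_ge k (m + 1) with h | h
    · exact huk k (by omega)
    · obtain rfl : k = m + 1 := le_antisymm hk h
      have hym : u (m + 1) - u m = ((1 + R) ^ m * R ^ (m - m)) y := hy m le_rfl
      have hum := huk m le_rfl
      rw [sub_eq_iff_eq_add] at hym
      rw [hym, hum]
      simp only [Nat.sub_self, Nat.succ_sub le_rfl, pow_zero, mul_one]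
      rw [show (1 + R) ^ (m + 1) = (1 + R) ^ m + (1 + R) ^ m * R by
        rw [pow_succ, mul_add, mul_one]]
      simp

theorem C0Semigroup.isChain_resolvent {S : C0Semigroup H} {R : H →L[ℂ] H}
    (hR : IsShiftInverse S.generator 1 R) (m : ℕ) (y : H) :
    S.IsChain m fun k => ((1 + R) ^ k * R ^ (m - k)) y := by
  have hc : Commute (1 + R) R := (Commute.one_left R).add_left (Commute.refl R)
  intro k hk
  have hz : ∀ z, S.HasGenLimit (R z) ((1 + R) z) := fun z => by
    have h := S.generator_spec ⟨R z, hR.mem_domain z⟩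
    have h2 := hR.right_inv z
    rw [one_smul, sub_eq_iff_eq_add] at h2
    rwa [h2] at h
  have h := hz (((1 + R) ^ k * R ^ (m - (k + 1))) y)
  have e1 : (1 + R) ^ k * R ^ (m - k) = R * ((1 + R) ^ k * R ^ (m - (k + 1))) := by
    rw [← mul_assoc, ← (hc.pow_left k).eq, mul_assoc, ← pow_succ',
      show m - (k + 1) + 1 = m - k by omega]
  have e2 : (1 + R) ^ (k + 1) * R ^ (m - (k + 1)) =
      (1 + R) * ((1 + R) ^ k * R ^ (m - (k + 1))) := by
    rw [pow_succ', mul_assoc]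
  simp only [e1, e2]
  exact h

/-- As soon as the cogenerator `V` exists, it is an `m`-isometry exactly when the infinitesimal
condition holds. -/
theorem C0Semigroup.IsCogenerator.isMIsometry_iff {S : C0Semigroup H} {V : H →L[ℂ] H}
    (hV : S.IsCogenerator V) (m : ℕ) :
    IsMIsometry m V ↔ ∀ u, S.IsChain m u → binomForm m u = 0 := by
  obtain ⟨R, hR, hV⟩ := hV
  have hVR : V = (1 + R) + R := by
    ext y
    have h2 := hR.right_inv y
    rw [one_smul, sub_eq_iff_eq_add] at h2
    rw [hV, h2]
    simp
  have hc : Commute (1 + R) R := (Commute.one_left R).add_left (Commute.refl R)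
  have key : ∀ (u : ℕ → H) (y : H), (∀ k ≤ m, u k = ((1 + R) ^ k * R ^ (m - k)) y) →
      defectForm V m y y = 2 ^ m * binomForm m u := fun u y hu => by
    rw [defectForm_eq_symForm hc (by abel) hVR, symForm, binomForm]
    congr 1
    refine Finset.sum_congr rfl fun ij h => ?_
    have h := mem_antidiagonal.1 h
    rw [hu ij.1 (by omega), hu ij.2 (by omega), show m - ij.1 = ij.2 by omega,
      show m - ij.2 = ij.1 by omega]
  rw [isMIsometry_iff_defectForm]
  constructor
  · intro h u hu
    obtain ⟨y, hy⟩ := hu.exists_resolvent_form hR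
    simpa [h y] using key u y hy
  · intro h y
    rw [key _ y fun k _ => rfl, h _ (C0Semigroup.isChain_resolvent hR m y), mul_zero]

/-! ### Regularity of orbits -/

namespace C0Semigroup

theorem map_add_apply (S : C0Semigroup H) (s t : ℝ≥0) (x : H) :
    S.T (s + t) x = S.T t (S.T s x) := by
  rw [S.map_add]; rfl

theorem map_zero_apply (S : C0Semigroup H) (x : H) : S.T 0 x = x := by
  rw [S.map_zero]; rfl

theorem map_comm_apply (S : C0Semigroup H) (s t : ℝ≥0) (x : H) :
    S.T s (S.T t x) = S.T t (S.T s x) := by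
  rw [← map_add_apply, ← map_add_apply, add_comm]

theorem map_nsmul (S : C0Semigroup H) (n : ℕ) (t : ℝ≥0) : S.T (n • t) = S.T t ^ n := by
  induction n with
  | zero => rw [zero_smul, S.map_zero]; rfl
  | succ n ih => rw [succ_nsmul, S.map_add, ih, pow_succ']; rfl

theorem tendsto_nhds_zero (S : C0Semigroup H) (x : H) :
    Tendsto (fun t : ℝ≥0 => S.T t x) (𝓝 0) (𝓝 x) := by
  have h := S.tendsto_zero x
  rw [show Set.Ioi (0 : ℝ≥0) = {0}ᶜ by ext; simp [pos_iff_ne_zero]] at h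
  have h0 : ContinuousAt (fun t : ℝ≥0 => S.T t x) 0 := by
    rw [continuousAt_iff_punctured_nhds, S.map_zero_apply]; exact h
  simpa [ContinuousAt, S.map_zero_apply] using h0

/-- Uniform boundedness near `0`: otherwise operators `T(tₙ)` with `tₙ → 0` would have unbounded
norms although `T(tₙ) x → x` for every `x`. -/
theorem exists_norm_le_near_zero [CompleteSpace H] (S : C0Semigroup H) :
    ∃ δ > (0 : ℝ≥0), ∃ M : ℝ, ∀ t ≤ δ, ‖S.T t‖ ≤ M := by
  by_contra! hcon
  have hpos : ∀ n : ℕ, (0 : ℝ≥0) < 1 / (n + 1) := fun n => by positivity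
  choose t ht hM using fun n : ℕ => hcon (1 / (n + 1)) (hpos n) n
  have ht0 : Tendsto t atTop (𝓝 0) :=
    tendsto_of_tendsto_of_tendsto_of_le_of_le tendsto_const_nhds
      tendsto_one_div_add_atTop_nhds_zero_nat (fun _ => zero_le) ht
  obtain ⟨C, hC⟩ := banach_steinhaus (g := fun n => S.T (t n)) fun x => by
    obtain ⟨C, hC⟩ := ((S.tendsto_nhds_zero x).comp ht0).norm.bddAbove_range
    exact ⟨C, fun n => hC ⟨n, rfl⟩⟩
  obtain ⟨n, hn⟩ := exists_nat_gt C
  exact (hn.trans (hM n)).not_ge (hC n)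

theorem exists_norm_le [CompleteSpace H] (S : C0Semigroup H) (K : ℝ≥0) :
    ∃ M : ℝ, ∀ t ≤ K, ‖S.T t‖ ≤ M := by
  obtain ⟨δ, hδ, M, hM⟩ := S.exists_norm_le_near_zero
  -- For `t ≤ K` the time `t / n` is at most `δ`, and `T(t) = T(t / n) ^ n`.
  obtain ⟨n, hn⟩ := exists_nat_gt (K / δ)
  have hn0 : (0 : ℝ≥0) < n := zero_le.trans_lt hn
  have hn0' : 0 < n := by exact_mod_cast hn0
  refine ⟨M ^ n, fun t ht => ?_⟩
  have e : t = n • (t / n) := by rw [nsmul_eq_mul, mul_div_cancel₀ _ hn0.ne']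
  rw [e, S.map_nsmul]
  refine (norm_pow_le' _ hn0').trans (pow_le_pow_left₀ (norm_nonneg _) (hM _ ?_) n)
  rw [div_le_iff₀ hn0, mul_comm]
  exact ht.trans ((div_le_iff₀ hδ).1 hn.le)

theorem continuous_apply [CompleteSpace H] (S : C0Semigroup H) (x : H) :
    Continuous fun t => S.T t x := by
  refine continuous_iff_continuousAt.2 fun s => ?_
  obtain ⟨M, hM⟩ := S.exists_norm_le (s + 1)
  have key : ∀ a b : ℝ≥0, a ≤ b → a ≤ s + 1 →
      ‖S.T b x - S.T a x‖ ≤ M * ‖S.T (b - a) x - x‖ := fun a b hab ha => by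
    have e : S.T b x = S.T a (S.T (b - a) x) := by
      rw [← S.map_add_apply, tsub_add_cancel_of_le hab]
    rw [e, ← map_sub]
    exact (S.T a).le_of_opNorm_le (hM a ha) _
  have hnn : Tendsto (fun t : ℝ≥0 => nndist t s) (𝓝 s) (𝓝 0) := by
    have h : Continuous fun t : ℝ≥0 => nndist t s := by fun_prop
    simpa using h.tendsto s
  have hlim : Tendsto (fun t : ℝ≥0 => M * ‖S.T (nndist t s) x - x‖) (𝓝 s) (𝓝 0) := by
    simpa using ((((S.tendsto_nhds_zero x).comp hnn).sub_const x).norm).const_mul M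
  refine tendsto_iff_norm_sub_tendsto_zero.2
    (squeeze_zero' (Eventually.of_forall fun _ => norm_nonneg _) ?_ hlim)
  filter_upwards [eventually_le_nhds (lt_add_of_pos_right s zero_lt_one)] with t ht
  rcases le_total t s with h | h
  · rw [norm_sub_rev, NNReal.nndist_eq, max_eq_right (by simp [tsub_eq_zero_of_le h])]
    exact key t s h ht
  · rw [NNReal.nndist_eq, max_eq_left (by simp [tsub_eq_zero_of_le h])]
    exact key s t h (le_add_of_nonneg_right zero_le_one)

/-- The orbit `t ↦ T(t) x` on the real line, extended by the constant `x` to `t < 0`. -/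
def orbit (S : C0Semigroup H) (x : H) (t : ℝ) : H := S.T t.toNNReal x

theorem continuous_orbit [CompleteSpace H] (S : C0Semigroup H) (x : H) :
    Continuous (S.orbit x) :=
  (S.continuous_apply x).comp continuous_real_toNNReal

theorem orbit_coe (S : C0Semigroup H) (x : H) (t : ℝ≥0) : S.orbit x t = S.T t x := by
  rw [orbit, Real.toNNReal_coe]

theorem orbit_zero (S : C0Semigroup H) (x : H) : S.orbit x 0 = x := by
  rw [orbit, Real.toNNReal_zero, S.map_zero_apply]

theorem map_orbit (S : C0Semigroup H) (x : H) {s t : ℝ} (hs : 0 ≤ s) (ht : 0 ≤ t) :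
    S.T t.toNNReal (S.orbit x s) = S.orbit x (t + s) := by
  rw [orbit, orbit, ← S.map_add_apply, add_comm t, Real.toNNReal_add hs ht]

/-- The generator is the right derivative of the orbit at `0`. -/
theorem hasGenLimit_iff (S : C0Semigroup H) (x y : H) :
    S.HasGenLimit x y ↔ HasDerivWithinAt (S.orbit x) y (Set.Ici 0) 0 := by
  rw [← hasDerivWithinAt_Ioi_iff_Ici, hasDerivWithinAt_iff_tendsto_slope' Set.self_notMem_Ioi]
  have h1 : Tendsto (fun t : ℝ≥0 => (t : ℝ)) (𝓝[>] 0) (𝓝[>] 0) := by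
    refine tendsto_nhdsWithin_iff.2
      ⟨NNReal.continuous_coe.continuousWithinAt, ?_⟩
    filter_upwards [self_mem_nhdsWithin] with t ht
    exact NNReal.coe_pos.2 ht
  have h2 : Tendsto Real.toNNReal (𝓝[>] 0) (𝓝[>] 0) := by
    refine tendsto_nhdsWithin_iff.2
      ⟨by simpa using (continuous_real_toNNReal.tendsto 0).mono_left nhdsWithin_le_nhds, ?_⟩
    filter_upwards [self_mem_nhdsWithin] with t ht
    exact Real.toNNReal_pos.2 ht
  constructor
  · intro h
    refine (h.comp h2).congr' ?_
    filter_upwards [self_mem_nhdsWithin] with t ht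
    rw [slope_def_module, S.orbit_zero, sub_zero, Function.comp_apply,
      Real.coe_toNNReal _ (le_of_lt ht), ← Complex.ofReal_inv, Complex.coe_smul]
    rfl
  · intro h
    refine (h.comp h1).congr fun t => ?_
    rw [Function.comp_apply, slope_def_module, S.orbit_zero, sub_zero, S.orbit_coe,
      ← Complex.ofReal_inv, Complex.coe_smul]

theorem HasGenLimit.hasDerivWithinAt_orbit {S : C0Semigroup H} {x y : H}
    (h : S.HasGenLimit x y) {t : ℝ} (ht : 0 ≤ t) :
    HasDerivWithinAt (S.orbit x) (S.orbit y t) (Set.Ici t) t := by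
  have h0 := (S.hasGenLimit_iff x y).1 h
  have h1 : HasDerivWithinAt (fun s => S.orbit x (s - t)) y (Set.Ici t) t := by
    have := HasDerivWithinAt.scomp_of_eq t h0 ((hasDerivAt_id t).sub_const t).hasDerivWithinAt
      (s := Set.Ici t) (fun s (hs : t ≤ s) => sub_nonneg.2 hs) (by simp)
    simpa [Function.comp_def] using this
  have h2 := (((S.T t.toNNReal).restrictScalars ℝ).hasFDerivAt).comp_hasDerivWithinAt t h1
  refine h2.congr_of_mem (fun s hs => ?_) Set.self_mem_Ici
  have := S.map_orbit x (sub_nonneg.2 hs) ht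
  rw [add_sub_cancel] at this
  exact this.symm

theorem HasGenLimit.map {S : C0Semigroup H} {x y : H} (h : S.HasGenLimit x y) {L : H →L[ℂ] H}
    (hL : ∀ t z, L (S.T t z) = S.T t (L z)) : S.HasGenLimit (L x) (L y) := by
  refine ((L.continuous.tendsto y).comp h).congr fun t => ?_
  simp [hL]

/-! ### Integrals of orbits -/

/-- Weighted integrals of orbits define bounded operators that commute with the semigroup. -/
theorem exists_integral_operator [CompleteSpace H] (S : C0Semigroup H)
    (μ : MeasureTheory.Measure ℝ) {w b : ℝ → ℝ} (hw : Continuous w)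
    (hb : MeasureTheory.Integrable b μ) (hwb : ∀ᵐ t ∂μ, ‖w t‖ * ‖S.T t.toNNReal‖ ≤ b t) :
    ∃ L : H →L[ℂ] H, (∀ x, MeasureTheory.Integrable (fun t => w t • S.orbit x t) μ) ∧
      (∀ x, L x = ∫ t, w t • S.orbit x t ∂μ) ∧ ∀ t x, L (S.T t x) = S.T t (L x) := by
  have hle : ∀ x, ∀ᵐ t ∂μ, ‖w t • S.orbit x t‖ ≤ b t * ‖x‖ := fun x => by
    filter_upwards [hwb] with t ht
    rw [norm_smul]
    refine le_trans ?_ (mul_le_mul_of_nonneg_right ht (norm_nonneg x))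
    rw [mul_assoc]
    exact mul_le_mul_of_nonneg_left ((S.T _).le_opNorm x) (norm_nonneg _)
  have hint : ∀ x, MeasureTheory.Integrable (fun t => w t • S.orbit x t) μ := fun x =>
    (hb.mul_const ‖x‖).mono' (hw.smul (S.continuous_orbit x)).aestronglyMeasurable (hle x)
  refine ⟨LinearMap.mkContinuous
    { toFun := fun x => ∫ t, w t • S.orbit x t ∂μ
      map_add' := fun x y => ?_
      map_smul' := fun c x => ?_ } (∫ t, b t ∂μ) fun x => ?_, hint, fun x => rfl, fun t x => ?_⟩
  · rw [← MeasureTheory.integral_add (hint x) (hint y)]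
    simp [orbit]
  · rw [RingHom.id_apply, ← MeasureTheory.integral_smul]
    simp [orbit, smul_comm c]
  · refine (MeasureTheory.norm_integral_le_of_norm_le (hb.mul_const ‖x‖) (hle x)).trans_eq ?_
    exact MeasureTheory.integral_mul_const _ _
  · change ∫ s, w s • S.orbit (S.T t x) s ∂μ = S.T t (∫ s, w s • S.orbit x s ∂μ)
    rw [← ContinuousLinearMap.integral_comp_comm _ (hint x)]
    refine MeasureTheory.integral_congr_ae (Eventually.of_forall fun s => ?_)
    change w s • S.T _ (S.T t x) = S.T t (w s • S.T _ x)
    rw [map_comm_apply, ← Complex.coe_smul, ← Complex.coe_smul, map_smul]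

/-- Averages of an orbit lie in the domain of the generator. -/
theorem hasGenLimit_intervalIntegral [CompleteSpace H] (S : C0Semigroup H) (x : H) {h : ℝ}
    (hh : 0 ≤ h) : S.HasGenLimit (∫ s in 0..h, S.orbit x s) (S.orbit x h - x) := by
  have hc := S.continuous_orbit x
  rw [hasGenLimit_iff]
  have h1 : HasDerivAt (fun t => ∫ s in 0..t, S.orbit x s) x 0 := by
    simpa [S.orbit_zero] using (hc.integral_hasStrictDerivAt 0 0).hasDerivAt
  have h2 : HasDerivAt (fun t => ∫ s in 0..t + h, S.orbit x s) (S.orbit x h) 0 := by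
    refine HasDerivAt.comp_add_const (f := fun u => ∫ s in 0..u, S.orbit x s) 0 h ?_
    simpa using (hc.integral_hasStrictDerivAt 0 h).hasDerivAt
  refine (h2.sub h1).hasDerivWithinAt.congr_of_mem (fun t ht => ?_) Set.self_mem_Ici
  have ht : 0 ≤ t := ht
  change S.T t.toNNReal _ = (∫ s in 0..t + h, S.orbit x s) - ∫ s in 0..t, S.orbit x s
  rw [intervalIntegral.integral_interval_sub_left (hc.intervalIntegrable _ _)
    (hc.intervalIntegrable _ _),
    ← ContinuousLinearMap.intervalIntegral_comp_comm _ (hc.intervalIntegrable _ _)]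
  have := intervalIntegral.integral_comp_add_left (a := 0) (b := h) (S.orbit x) t
  rw [add_zero] at this
  rw [← this]
  refine intervalIntegral.integral_congr fun s hs => ?_
  rw [Set.uIcc_of_le hh] at hs
  exact S.map_orbit x hs.1 ht

/-- The domain `D(A ^ m)` is dense. -/
theorem dense_chain [CompleteSpace H] (S : C0Semigroup H) (m : ℕ) :
    Dense {x | ∃ u, S.IsChain m u ∧ u 0 = x} := by
  induction m with
  | zero => exact fun x => subset_closure ⟨fun _ => x, fun k hk => absurd hk k.not_lt_zero, rfl⟩
  | succ m ih =>
    refine Dense.of_closure (ih.mono ?_)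
    rintro _ ⟨u, hu, rfl⟩
    have hlim : Tendsto (fun h : ℝ => h⁻¹ • ∫ s in 0..h, S.orbit (u 0) s) (𝓝[>] 0)
        (𝓝 (u 0)) := by
      have hd := ((S.continuous_orbit (u 0)).integral_hasStrictDerivAt 0 0).hasDerivAt
      have := (hasDerivWithinAt_iff_tendsto_slope' Set.self_notMem_Ioi).1
        (hd.hasDerivWithinAt (s := Set.Ioi 0))
      rw [S.orbit_zero] at this
      refine this.congr fun h => ?_
      simp [slope_def_module]
    refine mem_closure_of_tendsto hlim ?_
    filter_upwards [self_mem_nhdsWithin] with h (hh : 0 < h)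
    -- Averaging over `[0, h]` commutes with `A`, so it prolongs a chain of length `m` by one step.
    obtain ⟨M, hM⟩ := S.exists_norm_le h.toNNReal
    obtain ⟨L, -, hL, hcomm⟩ := S.exists_integral_operator
      (MeasureTheory.volume.restrict (Set.Ioc 0 h)) (w := fun _ => 1) (b := fun _ => M)
      continuous_const (MeasureTheory.integrable_const M) (by
        refine (MeasureTheory.ae_restrict_iff' measurableSet_Ioc).2
          (Eventually.of_forall fun t ht => ?_)
        simpa using hM _ (Real.toNNReal_le_toNNReal ht.2))
    have hL' : ∀ x, L x = ∫ s in 0..h, S.orbit x s := fun x => by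
      rw [hL, intervalIntegral.integral_of_le hh.le]
      simp
    refine ⟨fun k => ((h⁻¹ : ℝ) : ℂ) •
      if k ≤ m then L (u k) else S.orbit (u m) h - u m, fun k hk => ?_, ?_⟩
    · refine HasGenLimit.smul _ ?_
      have hkm : k ≤ m := Nat.lt_succ_iff.1 hk
      rw [if_pos hkm]
      split_ifs with hk'
      · exact (hu k hk').map hcomm
      · obtain rfl : k = m := by omega
        rw [hL']
        exact S.hasGenLimit_intervalIntegral _ hh.le
    · simp only [zero_le, if_true, hL', Complex.coe_smul]

end C0Semigroup

/-! ### Finite differences and polynomials -/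

theorem sum_choose_eval_eq_zero {m : ℕ} (hm : 0 < m) {p : Polynomial ℝ}
    (hp : p.degree < (m : WithBot ℕ)) (s t : ℝ) :
    ∑ k ∈ Finset.range (m + 1),
      (m.choose k : ℝ) * (-1 : ℝ) ^ (m - k) * p.eval (s + k * t) = 0 := by
  have hpm : p.natDegree < m := by
    rcases eq_or_ne p 0 with rfl | h0
    · simpa using hm
    · exact (Polynomial.natDegree_lt_iff_degree_lt h0).2 hp
  have hq : (p.comp (Polynomial.C t * Polynomial.X + Polynomial.C s)).natDegree < m := by
    refine (Polynomial.natDegree_comp_le.trans ?_).trans_lt hpm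
    exact (Nat.mul_le_mul_left _ Polynomial.natDegree_linear_le).trans_eq (mul_one _)
  have h := congrFun (Polynomial.fwdDiff_iter_eq_zero_of_degree_lt hq) 0
  rw [fwdDiff_iter_eq_sum_shift] at h
  refine Eq.trans (Finset.sum_congr rfl fun k _ => ?_) h
  simp only [Polynomial.eval_comp, zsmul_eq_mul]
  push_cast
  simp
  ring_nf

/-- The vanishing of the `m`-th differences is a recursion of order `m`. -/
theorem eq_zero_of_sum_choose_eq_zero {m : ℕ} {a : ℕ → ℝ}
    (ha : ∀ n, ∑ k ∈ Finset.range (m + 1),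
      (m.choose k : ℝ) * (-1 : ℝ) ^ (m - k) * a (n + k) = 0)
    (h0 : ∀ k < m, a k = 0) (n : ℕ) : a n = 0 := by
  induction n using Nat.strong_induction_on with
  | _ n ih =>
    rcases lt_or_ge n m with h | h
    · exact h0 n h
    · have := ha (n - m)
      rw [Finset.sum_range_succ, Finset.sum_eq_zero fun k hk => ?_] at this
      · simpa [Nat.sub_add_cancel h] using this
      · rw [ih _ (by have := Finset.mem_range.1 hk; omega), mul_zero]

/-- A function with vanishing `m`-th differences agrees on every arithmetic progression
`0, d, 2d, …` with its Lagrange interpolant at the first `m` points. -/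
theorem exists_polynomial_on_grid {m : ℕ} (hm : 0 < m) {f : ℝ → ℝ}
    (hf : ∀ s t, 0 ≤ s → 0 ≤ t → ∑ k ∈ Finset.range (m + 1),
      (m.choose k : ℝ) * (-1 : ℝ) ^ (m - k) * f (s + k * t) = 0) {d : ℝ} (hd : 0 < d) :
    ∃ p : Polynomial ℝ, p.degree < (m : WithBot ℕ) ∧ ∀ k : ℕ, f (k * d) = p.eval (k * d) := by
  have hinj : Set.InjOn (fun k : ℕ => (k : ℝ) * d) (Finset.range m) := fun i _ j _ h =>
    Nat.cast_injective (mul_right_cancel₀ hd.ne' h)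
  have hdeg := Lagrange.degree_interpolate_lt (fun k : ℕ => f (k * d)) hinj
  rw [Finset.card_range] at hdeg
  refine ⟨_, hdeg, fun k => sub_eq_zero.1 ?_⟩
  refine eq_zero_of_sum_choose_eq_zero (m := m)
    (a := fun k : ℕ => f (k * d) - Polynomial.eval (k * d) _) (fun n => ?_) (fun i hi => ?_) k
  · have e : ∀ k : ℕ, ((n + k : ℕ) : ℝ) * d = n * d + k * d := fun k => by push_cast; ring
    simp only [e, mul_sub, Finset.sum_sub_distrib]
    rw [hf _ _ (by positivity) hd.le, sum_choose_eval_eq_zero hm hdeg, sub_zero]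
  · exact sub_eq_zero.2
      (Lagrange.eval_interpolate_at_node (fun k : ℕ => f (k * d)) hinj
        (Finset.mem_range.2 hi)).symm

/-- **Fréchet's theorem** on the half-line: a continuous function all of whose `m`-th differences
vanish is a polynomial of degree less than `m`. -/
theorem exists_polynomial_of_sum_choose_eq_zero {m : ℕ} (hm : 0 < m) {f : ℝ → ℝ}
    (hc : Continuous f)
    (hf : ∀ s t, 0 ≤ s → 0 ≤ t → ∑ k ∈ Finset.range (m + 1),
      (m.choose k : ℝ) * (-1 : ℝ) ^ (m - k) * f (s + k * t) = 0) :
    ∃ p : Polynomial ℝ, p.degree < (m : WithBot ℕ) ∧ ∀ t, 0 ≤ t → f t = p.eval t := by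
  obtain ⟨p, hp, hpk⟩ := exists_polynomial_on_grid hm hf one_pos
  have key : ∀ n k : ℕ, f (k / (n + 1)) = p.eval ((k : ℝ) / (n + 1)) := fun n k => by
    have hn : (0 : ℝ) < n + 1 := by positivity
    obtain ⟨q, -, hqk⟩ := exists_polynomial_on_grid hm hf (one_div_pos.2 hn)
    -- The grid of mesh `1 / (n + 1)` contains the integers, where `p` and `q` both agree with `f`.
    have hqp : q = p := by
      refine Polynomial.eq_of_infinite_eval_eq _ _
        (Set.Infinite.mono ?_ (Set.infinite_range_of_injective (Nat.cast_injective (R := ℝ))))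
      rintro _ ⟨j, rfl⟩
      have h1 := hpk j
      have h2 := hqk (j * (n + 1))
      have e : ((j * (n + 1) : ℕ) : ℝ) * (1 / (n + 1)) = j := by
        push_cast; field_simp
      rw [e] at h2
      rw [mul_one] at h1
      exact h2.symm.trans h1
    have h := hqk k
    rwa [hqp, mul_one_div] at h
  refine ⟨p, hp, fun t ht => ?_⟩
  have hlim : Tendsto (fun n : ℕ => (⌊t * ((n : ℝ) + 1)⌋₊ : ℝ) / ((n : ℝ) + 1)) atTop (𝓝 t) :=
    (tendsto_nat_floor_mul_div_atTop ht).comp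
      (tendsto_atTop_add_const_right _ 1 tendsto_natCast_atTop_atTop)
  refine tendsto_nhds_unique ((hc.tendsto t).comp hlim) ?_
  refine ((p.continuous.tendsto t).comp hlim).congr fun n => ?_
  exact (key n _).symm

/-- Taylor's formula without remainder, for iterated right derivatives on the half-line. -/
theorem eq_sum_of_hasDerivWithinAt {m : ℕ} {g : ℕ → ℝ → ℝ} (hc : ∀ n, Continuous (g n))
    (hd : ∀ n < m, ∀ t, 0 ≤ t → HasDerivWithinAt (g n) (g (n + 1) t) (Set.Ici t) t)
    (h0 : ∀ t, 0 ≤ t → g m t = 0) (t : ℝ) (ht : 0 ≤ t) :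
    g 0 t = ∑ n ∈ Finset.range m, g n 0 / n.factorial * t ^ n := by
  induction m generalizing g t with
  | zero => simpa using h0 t ht
  | succ m ih =>
    have ih' := fun s hs => ih (g := fun n => g (n + 1)) (fun n => hc _)
      (fun n hn => hd _ (by omega)) h0 s hs
    have hP : ∀ s : ℝ, HasDerivAt
        (fun t => ∑ n ∈ Finset.range (m + 1), g n 0 / n.factorial * t ^ n)
        (∑ n ∈ Finset.range m, g (n + 1) 0 / n.factorial * s ^ n) s := fun s => by
      simp only [Finset.sum_range_succ' _ m, pow_zero]
      refine HasDerivAt.add_const _ (HasDerivAt.fun_sum fun n _ => ?_)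
      have := (hasDerivAt_pow (n + 1) s).const_mul (g (n + 1) 0 / (n + 1).factorial)
      refine this.congr_deriv ?_
      rw [Nat.factorial_succ]
      push_cast
      field_simp
    have hcont : Continuous fun t : ℝ => g 0 t -
        ∑ n ∈ Finset.range (m + 1), g n 0 / n.factorial * t ^ n :=
      (hc 0).sub (by fun_prop)
    have := constant_of_has_deriv_right_zero (a := 0) (b := t) hcont.continuousOn
      (fun s hs => by
        have h := (hd 0 m.succ_pos s hs.1).sub (hP s).hasDerivWithinAt
        rw [← ih' s hs.1, sub_self] at h
        exact h) t ⟨ht, le_rfl⟩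
    rw [sub_eq_iff_eq_add] at this
    rw [this]
    simp [Finset.sum_range_succ' _ m]

theorem exists_eval_le_mul_exp (p : Polynomial ℝ) :
    ∃ C : ℝ, ∀ t, 0 ≤ t → p.eval t ≤ C * Real.exp t := by
  refine ⟨∑ i ∈ Finset.range (p.natDegree + 1), |p.coeff i| * i.factorial, fun t ht => ?_⟩
  rw [Polynomial.eval_eq_sum_range, Finset.sum_mul]
  refine Finset.sum_le_sum fun i _ => ?_
  rw [mul_assoc]
  refine mul_le_mul (le_abs_self _) ?_ (by positivity) (abs_nonneg _)
  have h := Real.pow_div_factorial_le_exp t ht i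
  rwa [div_le_iff₀ (by positivity), mul_comm] at h

/-! ### Derivatives of the squared norm along an orbit -/

namespace C0Semigroup

theorem IsChain.hasDerivWithinAt_binomForm {S : C0Semigroup H} {m : ℕ} {u : ℕ → H}
    (hu : S.IsChain m u) {n : ℕ} (hn : n < m) {t : ℝ} (ht : 0 ≤ t) :
    HasDerivWithinAt (fun t => binomForm n fun k => S.orbit (u k) t)
      (binomForm (n + 1) fun k => S.orbit (u k) t) (Set.Ici t) t := by
  have e : (binomForm (n + 1) fun k => S.orbit (u k) t) = ∑ ij ∈ antidiagonal n,
      n.choose ij.1 • (⟪S.orbit (u ij.2) t, S.orbit (u (ij.1 + 1)) t⟫_ℂ +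
        ⟪S.orbit (u (ij.2 + 1)) t, S.orbit (u ij.1) t⟫_ℂ) := by
    rw [binomForm, Finset.sum_antidiagonal_choose_succ_nsmul
      (fun i j => ⟪S.orbit (u j) t, S.orbit (u i) t⟫_ℂ), add_comm, ← Finset.sum_add_distrib]
    refine Finset.sum_congr rfl fun ij h => ?_
    rw [Nat.choose_symm_of_eq_add (mem_antidiagonal.1 h).symm, smul_add]
  rw [e]
  refine HasDerivWithinAt.fun_sum fun ij h => ?_
  have h := mem_antidiagonal.1 h
  have h1 := (hu ij.1 (by omega)).hasDerivWithinAt_orbit ht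
  have h2 := (hu ij.2 (by omega)).hasDerivWithinAt_orbit ht
  exact (h2.inner ℂ h1).const_smul (n.choose ij.1)

theorem binomForm_zero (v : ℕ → H) : binomForm 0 v = ((‖v 0‖ ^ 2 : ℝ) : ℂ) := by
  simp [binomForm, inner_self_eq_norm_sq_to_K]

theorem IsChain.exists_polynomial [CompleteSpace H] {S : C0Semigroup H} {m : ℕ}
    (h0 : ∀ u, S.IsChain m u → binomForm m u = 0) {u : ℕ → H} (hu : S.IsChain m u) :
    ∃ p : Polynomial ℝ, p.degree < (m : WithBot ℕ) ∧
      ∀ t, 0 ≤ t → ‖S.orbit (u 0) t‖ ^ 2 = p.eval t := by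
  have hc : ∀ k, Continuous (S.orbit (u k)) := fun k => S.continuous_orbit _
  have key := eq_sum_of_hasDerivWithinAt (m := m)
    (g := fun n t => (binomForm n fun k => S.orbit (u k) t).re)
    (fun n => by
      unfold binomForm
      fun_prop)
    (fun n hn t ht =>
      Complex.reCLM.hasFDerivAt.comp_hasDerivWithinAt t (hu.hasDerivWithinAt_binomForm hn ht))
    (fun t _ => by
      rw [h0 (fun k => S.orbit (u k) t) fun k hk => (hu k hk).map fun s z => S.map_comm_apply _ s z]
      rfl)
  refine ⟨∑ n ∈ Finset.range m, Polynomial.monomial n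
    ((binomForm n fun k => S.orbit (u k) 0).re / n.factorial), ?_, fun t ht => ?_⟩
  · rw [← Polynomial.mem_degreeLT]
    refine Submodule.sum_mem _ fun n hn => Polynomial.mem_degreeLT.2 ?_
    exact (Polynomial.degree_monomial_le _ _).trans_lt
      (by exact_mod_cast Finset.mem_range.1 hn)
  · have := key t ht
    simp only [binomForm_zero, Complex.ofReal_re] at this
    rw [this, Polynomial.eval_finsetSum]
    simp only [Polynomial.eval_monomial]

/-- If `‖T(t) u₀‖²` is the polynomial `p`, then the `n`-th form along the orbit is `p⁽ⁿ⁾`. -/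
theorem IsChain.binomForm_eq_zero {S : C0Semigroup H} {m : ℕ} {u : ℕ → H}
    (hu : S.IsChain m u) {p : Polynomial ℝ} (hp : p.degree < (m : WithBot ℕ))
    (h : ∀ t, 0 ≤ t → ‖S.orbit (u 0) t‖ ^ 2 = p.eval t) : binomForm m u = 0 := by
  have key : ∀ n ≤ m, ∀ t, 0 ≤ t → (binomForm n fun k => S.orbit (u k) t) =
      (((Polynomial.derivative^[n] p).eval t : ℝ) : ℂ) := fun n => by
    induction n with
    | zero => exact fun _ t ht => by rw [binomForm_zero, h t ht]; rfl
    | succ n ih =>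
      intro hn t ht
      have h1 := hu.hasDerivWithinAt_binomForm hn ht
      have h2 := (((Polynomial.derivative^[n] p).hasDerivAt t).ofReal_comp).hasDerivWithinAt
        (s := Set.Ici t)
      have h3 := h2.congr_of_mem (fun s hs => ih (by omega) s (le_trans ht hs)) Set.self_mem_Ici
      rw [Function.iterate_succ_apply']
      exact (uniqueDiffOn_Ici t t Set.self_mem_Ici).eq_deriv _ h1 h3
  have := key m le_rfl 0 le_rfl
  rw [Polynomial.iterate_derivative_eq_zero_of_degree_lt hp] at this
  simpa [S.orbit_zero] using this

/-! ### The resolvent at `1` -/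

/-- Polynomial growth of every `‖T(t) x‖²` gives a uniform exponential bound of rate `1/2`, by the
uniform boundedness principle for `e^{-t/2} T(t)`; any rate below `1` would do for the resolvent. -/
theorem exists_norm_le_mul_exp [CompleteSpace H] (S : C0Semigroup H)
    (h : ∀ x : H, ∃ p : Polynomial ℝ, ∀ t : ℝ≥0, ‖S.T t x‖ ^ 2 = p.eval (t : ℝ)) :
    ∃ K : ℝ, ∀ t : ℝ≥0, ‖S.T t‖ ≤ K * Real.exp ((1 / 2) * t) := by
  obtain ⟨K, hK⟩ := banach_steinhaus
    (g := fun t : ℝ≥0 => ((Real.exp (-((1 / 2) * t)) : ℝ) : ℂ) • S.T t) fun x => by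
      obtain ⟨p, hp⟩ := h x
      obtain ⟨C, hC⟩ := exists_eval_le_mul_exp p
      refine ⟨Real.sqrt C, fun t => Real.le_sqrt_of_sq_le ?_⟩
      have hx := hC t t.2
      rw [← hp] at hx
      rw [smul_apply, norm_smul, Complex.norm_real, Real.norm_eq_abs, Real.abs_exp,
        mul_pow, ← Real.exp_nat_mul]
      refine (mul_le_mul_of_nonneg_left hx (Real.exp_pos _).le).trans_eq ?_
      rw [mul_left_comm, ← Real.exp_add]
      ring_nf
      simp
  refine ⟨K, fun t => ?_⟩
  have := hK t
  rw [norm_smul, Complex.norm_real, Real.norm_eq_abs, Real.abs_exp, Real.exp_neg,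
    inv_mul_le_iff₀ (Real.exp_pos _)] at this
  linarith

/-- The Laplace transform `L = ∫₀^∞ e^{-s} T(s) ds` maps into the domain, with `A L = L - 1`. -/
theorem hasGenLimit_laplace [CompleteSpace H] {S : C0Semigroup H} {L : H →L[ℂ] H}
    (hint : ∀ x, MeasureTheory.IntegrableOn (fun t => Real.exp (-t) • S.orbit x t) (Set.Ioi 0))
    (hL : ∀ x, L x = ∫ t in Set.Ioi 0, Real.exp (-t) • S.orbit x t)
    (hcomm : ∀ t x, L (S.T t x) = S.T t (L x)) (x : H) : S.HasGenLimit (L x) (L x - x) := by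
  set F : ℝ → H := fun s => Real.exp (-s) • S.orbit x s with hF
  have hFc : Continuous F := by
    have := S.continuous_orbit x
    fun_prop
  have horb : ∀ t, 0 ≤ t → S.orbit (L x) t = Real.exp t • (L x - ∫ s in 0..t, F s) := by
    intro t ht
    have hshift := (MeasureTheory.measurePreserving_add_right MeasureTheory.volume
      t).setIntegral_preimage_emb (measurableEmbedding_addRight t) F (Set.Ioi t)
    rw [Set.preimage_add_const_Ioi, sub_self] at hshift
    have hsub := intervalIntegral.integral_interval_add_Ioi (hint x)
      ((hint x).mono_set (Set.Ioi_subset_Ioi ht))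
    rw [← hL, ← hF, ← hshift] at hsub
    rw [← eq_sub_of_add_eq' hsub, orbit, ← hcomm, hL, ← MeasureTheory.integral_smul]
    refine MeasureTheory.setIntegral_congr_fun measurableSet_Ioi fun s (hs : 0 < s) => ?_
    have e : S.orbit (S.T t.toNNReal x) s = S.orbit x (s + t) := S.map_orbit x ht hs.le
    simp only [hF]
    rw [e, smul_smul, ← Real.exp_add]
    ring_nf
  rw [hasGenLimit_iff]
  have hI : HasDerivAt (fun t => ∫ s in 0..t, F s) x 0 := by
    simpa [hF, S.orbit_zero] using (hFc.integral_hasStrictDerivAt 0 0).hasDerivAt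
  have hd := (Real.hasDerivAt_exp 0).smul (hI.const_sub (L x))
  have hd' : HasDerivAt (fun t => Real.exp t • (L x - ∫ s in 0..t, F s)) (L x - x) 0 := by
    refine hd.congr_deriv ?_
    simp [sub_eq_neg_add]
  exact hd'.hasDerivWithinAt.congr_of_mem (fun t ht => horb t ht) Set.self_mem_Ici

theorem one_mem_resolventSet [CompleteSpace H] (S : C0Semigroup H)
    (h : ∀ x : H, ∃ p : Polynomial ℝ, ∀ t : ℝ≥0, ‖S.T t x‖ ^ 2 = p.eval (t : ℝ)) :
    (1 : ℂ) ∈ resolventSet S.generator := by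
  obtain ⟨K, hK⟩ := S.exists_norm_le_mul_exp h
  obtain ⟨L, hint, hL, hcomm⟩ := S.exists_integral_operator
    (MeasureTheory.volume.restrict (Set.Ioi 0)) (w := fun t => Real.exp (-t))
    (b := fun t => K * Real.exp (-(1 / 2) * t)) (by fun_prop)
    ((exp_neg_integrableOn_Ioi 0 one_half_pos).const_mul K) (by
      refine (MeasureTheory.ae_restrict_iff' measurableSet_Ioi).2
        (Eventually.of_forall fun t (ht : 0 < t) => ?_)
      have := hK t.toNNReal
      rw [Real.coe_toNNReal _ ht.le] at this
      rw [Real.norm_eq_abs, Real.abs_exp]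
      refine (mul_le_mul_of_nonneg_left this (Real.exp_pos _).le).trans_eq ?_
      rw [mul_left_comm, ← Real.exp_add]
      ring_nf)
  have hgen := hasGenLimit_laplace hint hL hcomm
  have hgen' : ∀ y, S.HasGenLimit ((-L) y) (y - L y) := fun y => by
    simpa using (hgen y).smul (-1)
  refine ⟨-L, fun y => ⟨_, hgen' y⟩, fun y => ?_, fun x => ?_⟩
  · rw [(S.generator_spec ⟨_, _, hgen' y⟩).unique (hgen' y)]
    simp
  · have hx := ((S.generator_spec x).map hcomm).unique (hgen x)
    simp [hx]

/-! ### The equivalences -/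

theorem map_pow_apply (S : C0Semigroup H) (t : ℝ≥0) (k : ℕ) (x : H) :
    (S.T t ^ k) x = S.orbit x (k * t) := by
  rw [← S.map_nsmul, ← S.orbit_coe]
  simp

theorem sum_choose_norm_eq_zero {S : C0Semigroup H} {m : ℕ} (hm : 0 < m) {x : H}
    {p : Polynomial ℝ} (hp : p.degree < (m : WithBot ℕ))
    (h : ∀ t, 0 ≤ t → ‖S.orbit x t‖ ^ 2 = p.eval t) (t : ℝ≥0) :
    ∑ k ∈ Finset.range (m + 1),
      (m.choose k : ℝ) * (-1 : ℝ) ^ (m - k) * ‖(S.T t ^ k) x‖ ^ 2 = 0 := by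
  rw [← sum_choose_eval_eq_zero hm hp 0 t]
  refine Finset.sum_congr rfl fun k _ => ?_
  rw [S.map_pow_apply, h _ (by positivity), zero_add]

theorem exists_polynomial_of_isMIsometry [CompleteSpace H] {S : C0Semigroup H} {m : ℕ}
    (hm : 0 < m) (h : ∀ t, IsMIsometry m (S.T t)) (x : H) :
    ∃ p : Polynomial ℝ, p.degree < (m : WithBot ℕ) ∧
      ∀ t : ℝ≥0, ‖S.T t x‖ ^ 2 = p.eval (t : ℝ) := by
  have hc := S.continuous_orbit x
  obtain ⟨p, hp, hpt⟩ := exists_polynomial_of_sum_choose_eq_zero hm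
    (f := fun t => ‖S.orbit x t‖ ^ 2) (by fun_prop) fun s t hs ht => by
      rw [← h t.toNNReal (S.orbit x s)]
      refine Finset.sum_congr rfl fun k _ => ?_
      have e : (k : ℝ) * t = ((k • t.toNNReal : ℝ≥0) : ℝ) := by simp [ht]
      rw [← S.map_nsmul, add_comm s, ← S.map_orbit x hs (by positivity), e,
        Real.toNNReal_coe]
  exact ⟨p, hp, fun t => by rw [← hpt t t.2, S.orbit_coe]⟩

theorem isMIsometry_of_binomForm_eq_zero [CompleteSpace H] {S : C0Semigroup H} {m : ℕ}
    (hm : 0 < m) (h : ∀ u, S.IsChain m u → binomForm m u = 0) (t : ℝ≥0) :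
    IsMIsometry m (S.T t) := by
  have hcl : IsClosed {x : H | ∑ k ∈ Finset.range (m + 1),
      (m.choose k : ℝ) * (-1 : ℝ) ^ (m - k) * ‖(S.T t ^ k) x‖ ^ 2 = 0} :=
    isClosed_eq (by fun_prop) continuous_const
  intro x
  refine hcl.closure_subset_iff.2 ?_ (S.dense_chain m x)
  rintro _ ⟨u, hu, rfl⟩
  obtain ⟨p, hp, hpt⟩ := IsChain.exists_polynomial h hu
  exact sum_choose_norm_eq_zero hm hp hpt t

end C0Semigroup

end SemigroupMIsometry

theorem mainTheorem1 {H : Type*} [NormedAddCommGroup H] [InnerProductSpace ℂ H]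
    [CompleteSpace H] [TopologicalSpace.SeparableSpace H]
    (S : SemigroupMIsometry.C0Semigroup H) (m : ℕ) (hm : 0 < m) :
    List.TFAE
      [ ∀ t : ℝ≥0, SemigroupMIsometry.IsMIsometry m (S.T t),
        ∀ x : H, ∃ p : Polynomial ℝ, p.degree < (m : WithBot ℕ) ∧
          ∀ t : ℝ≥0, ‖S.T t x‖ ^ 2 = p.eval (t : ℝ),
        ∀ x : (SemigroupMIsometry.opPow S.generator m).domain,
          ∑ k : Fin (m + 1), (m.choose k : ℂ) *
            ⟪SemigroupMIsometry.opPowOn S.generator (Nat.sub_le m k) x,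
              SemigroupMIsometry.opPowOn S.generator (Fin.is_le k) x⟫_ℂ = 0,
        ∃ V : H →L[ℂ] H, S.IsCogenerator V ∧ SemigroupMIsometry.IsMIsometry m V ] := by
  rw [S.forall_opPowOn_iff m]
  tfae_have 1 → 2 := SemigroupMIsometry.C0Semigroup.exists_polynomial_of_isMIsometry hm
  tfae_have 2 → 3 := fun h u hu => by
    obtain ⟨p, hp, hpt⟩ := h (u 0)
    exact hu.binomForm_eq_zero hp fun t ht => by
      rw [SemigroupMIsometry.C0Semigroup.orbit, hpt, Real.coe_toNNReal _ ht]
  tfae_have 3 → 1 := SemigroupMIsometry.C0Semigroup.isMIsometry_of_binomForm_eq_zero hm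
  tfae_have 2 → 4 := fun h => by
    obtain ⟨V, hV⟩ := S.exists_isCogenerator_iff.2
      (S.one_mem_resolventSet fun x => (h x).imp fun _ hp => hp.2)
    exact ⟨V, hV, (hV.isMIsometry_iff m).2 (tfae_2_to_3 h)⟩
  tfae_have 4 → 3 := fun ⟨_, hV, h⟩ => (hV.isMIsometry_iff m).1 h
  tfae_finish
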